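/- A hypergraph $\mathcal H=(V,\mathcal E)$ consists of a vertex set $V$ and a set $\mathcal E$ of subsets of $V$, its hyperedges (so there are no multiple hyperedges); it is $5$-uniform if every hyperedge has exactly $5$ elements. Its edge intersection hypergraph is $$EI(\mathcal H)=\bigl(V,\{e_1\cap e_2 : e_1,e_2\in\mathcal E,\ e_1\ne e_2,\ |e_1\cap e_2|\ge 2\}\bigr).$$ Let $C_n$ be the cycle with vertex set $V=\{1,2,\dots,n\}$ (taken modulo $n$) and edge set $\{\{i,i+1\} : i\in V\}$. For $k\ge 1$, a $k$-section of $e\subseteq V$ is a sequence $(i,i+1,\dots,i+k-1)$ (modulo $n$) with $\{i,i+1,\dots,i+k-1\}\subseteq e$, $i-1\notin e$ and $i+k\notin e$. A hyperedge is a $(3,2)$-hyperedge if it consists of exactly two sections, a $3$-section and a $2$-section. **Theorem.** Let $n\ge 18$. Then there exists a $5$-uniform hypergraph $\mathcal H=(V,\mathcal E)$ with $EI(\mathcal H)=C_n$ and $|\mathcal E|=\left\lceil \frac{2n}{3}\right\rceil$ such that all but at most two of the hyperedges of $\mathcal H$ are $(3,2)$-hyperedges. -/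

import Mathlib

namespace EdgeIntersection

/-- `H` is `k`-uniform: every hyperedge has exactly `k` vertices. -/
def IsUniform {α : Type*} (H : Hypergraph α) (k : ℕ) : Prop :=
  ∀ e ∈ H.edgeSet, e.encard = k

/-- The edge intersection hypergraph `EI(H)`: it has the same vertices as `H`, and its hyperedges
are the intersections of two distinct hyperedges of `H` that have at least two elements. -/
def EI {α : Type*} (H : Hypergraph α) : Hypergraph α where
  vertexSet := H.vertexSet
  edgeSet := {s | ∃ e₁ ∈ H.edgeSet, ∃ e₂ ∈ H.edgeSet,
    e₁ ≠ e₂ ∧ 2 ≤ (e₁ ∩ e₂).encard ∧ s = e₁ ∩ e₂}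
  subset_vertexSet_of_mem_edgeSet' := by
    rintro s ⟨e₁, h₁, e₂, -, -, -, rfl⟩
    exact Set.inter_subset_left.trans (H.subset_vertexSet_of_mem_edgeSet' h₁)

/-- The cycle `C_n`, as a 2-uniform hypergraph: the vertices are the integers modulo `n` and the
edges are the pairs `{i, i + 1}`. -/
def cycle (n : ℕ) : Hypergraph (ZMod n) where
  vertexSet := Set.univ
  edgeSet := Set.range fun i : ZMod n => {i, i + 1}
  subset_vertexSet_of_mem_edgeSet' := fun _ _ => Set.subset_univ _

/-- The set `{i, i + 1, …, i + k - 1}` of vertices of `C_n`. -/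
def arc {n : ℕ} (i : ZMod n) (k : ℕ) : Set (ZMod n) :=
  {v | ∃ j : ℕ, j < k ∧ v = i + (j : ZMod n)}

/-- `(i, i + 1, …, i + k - 1)` is a `k`-section of `e` on `C_n`: a nonempty sequence of consecutive
vertices contained in `e` that can be extended in neither direction. -/
def IsSection {n : ℕ} (e : Set (ZMod n)) (i : ZMod n) (k : ℕ) : Prop :=
  1 ≤ k ∧ arc i k ⊆ e ∧ i - 1 ∉ e ∧ i + (k : ZMod n) ∉ e

/-- For `l = [l₁, …, l_t]`, the set `e` is an `(l₁, …, l_t)`-hyperedge: `t ≥ 1`, `l₁ ≥ … ≥ l_t`, and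
`e` consists of `t` distinct sections, whose lengths are `l₁, …, l_t`. (Distinct sections of `e`
have distinct initial vertices.) -/
def IsSectionHyperedge {n : ℕ} (e : Set (ZMod n)) (l : List ℕ) : Prop :=
  l ≠ [] ∧ l.Pairwise (fun a b => b ≤ a) ∧
    ∃ s : Fin l.length → ZMod n, Function.Injective s ∧
      (∀ j, IsSection e (s j) (l.get j)) ∧ e = ⋃ j, arc (s j) (l.get j)

end EdgeIntersection

namespace EdgeIntersection

/-! Every hyperedge constructed is an arc of length 3 plus a separate arc of length 2, so the
exceptional set is empty. For `n = 3m + r` with `m ≥ 7`, `r ≤ 2`, take for each `i` modulo `m` a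
left edge, with triple from `3i` and pair from `3(i+3)+1`, and a right edge, with triple from `3i+2`
and pair from `3(i+2)+2`, block indices being reduced modulo `m`. Consecutive triples overlap in
`{3a, 3a+1}`, while the shifted pairs supply `{3a+1, 3a+2}` and `{3a+2, 3a+3}`. The `r` leftover
vertices each start one extra triple, giving `2m + r = ⌈2n/3⌉` hyperedges. The shifts 3 and 2 keep
two hyperedges from meeting in more than one edge of the cycle once `m ≥ 7`.
`exists_hypergraph_of_arcs` reduces the theorem to arithmetic of starting points, and
`isArcSystem_three_mul_add` supplies that arithmetic. -/

/-- The vertex `x < n` lies in the union of the arcs of lengths `3` and `2` starting at `s` and `t`,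
where all vertices are represented by natural numbers below `n`. -/
abbrev MemArcs (n s t x : ℕ) : Prop :=
  (s ≤ x ∧ x < s + 3 ∨ s ≤ x + n ∧ x + n < s + 3) ∨ (t ≤ x ∧ x < t + 2 ∨ t ≤ x + n ∧ x + n < t + 2)

/-- The arcs of lengths `3` and `2` starting at `s` and `t` are disjoint and not adjacent. -/
abbrev Separated (n s t : ℕ) : Prop :=
  s < n ∧ t < n ∧ (s + 4 ≤ t ∧ t + 3 ≤ s + n ∨ t + 3 ≤ s ∧ s + 4 ≤ t + n)

/-- Two unions of arcs meet in pairwise cyclically adjacent vertices. -/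
abbrev MeetAdjacent (n s t s' t' : ℕ) : Prop :=
  ∀ y < n, MemArcs n s t y ∧ MemArcs n s' t' y →
    ∀ x < y, MemArcs n s t x ∧ MemArcs n s' t' x → y = x + 1 ∨ y + 1 = x + n

/-- The vertex `k` and its successor both lie in the union of the arcs of lengths `3` and `2`
starting at `s` and `t`. -/
abbrev MemArcsSucc (n s t k : ℕ) : Prop :=
  MemArcs n s t k ∧ MemArcs n s t (if k + 1 = n then 0 else k + 1)

/-- The pairs of arcs starting at `s i` and `t i` form a hypergraph whose edge intersection
hypergraph is the cycle on `n` vertices, expressed in terms of natural numbers below `n`. -/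
structure IsArcSystem (n : ℕ) {ι : Type} (s t : ι → ℕ) : Prop where
  separated : ∀ i, Separated n (s i) (t i)
  meet : ∀ i j, i ≠ j → MeetAdjacent n (s i) (t i) (s j) (t j)
  cover : ∀ k < n, ∃ i j, i ≠ j ∧ MemArcsSucc n (s i) (t i) k ∧ MemArcsSucc n (s j) (t j) k

theorem MeetAdjacent.symm {n s t s' t' : ℕ} (h : MeetAdjacent n s t s' t') :
    MeetAdjacent n s' t' s t :=
  fun y hy h₁ x hx h₂ => h y hy h₁.symm x hx h₂.symm

/-- As `a < n` and `k ≤ n`, the arc passes 0 at most once; the alternatives are its parts before and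
after that wrap. -/
theorem mem_arc_natCast_iff {n a k : ℕ} [NeZero n] (ha : a < n) (hk : k ≤ n) (v : ZMod n) :
    v ∈ arc (a : ZMod n) k ↔ a ≤ v.val ∧ v.val < a + k ∨ a ≤ v.val + n ∧ v.val + n < a + k := by
  have hv := ZMod.val_lt v
  constructor
  · rintro ⟨j, hj, rfl⟩
    rw [← Nat.cast_add, ZMod.val_natCast]
    rcases lt_or_ge (a + j) n with h | h
    · rw [Nat.mod_eq_of_lt h]; omega
    · rw [Nat.mod_eq_sub_mod h, Nat.mod_eq_of_lt (by omega)]; omega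
  · rintro (h | h)
    · refine ⟨v.val - a, by omega, ?_⟩
      rw [← Nat.cast_add, Nat.add_sub_cancel' h.1, ZMod.natCast_zmod_val]
    · refine ⟨v.val + n - a, by omega, ?_⟩
      rw [← Nat.cast_add, Nat.add_sub_cancel' h.1]
      simp

theorem encard_arc {n k : ℕ} [NeZero n] (hk : k ≤ n) (i : ZMod n) : (arc i k).encard = k := by
  have h : arc i k = (fun j : ℕ => i + (j : ZMod n)) '' (Finset.range k : Set ℕ) := by
    ext v
    simp [arc, eq_comm]
  rw [h, Set.InjOn.encard_image, Set.encard_coe_eq_coe_finsetCard, Finset.card_range]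
  intro a ha b hb hab
  simp only [Finset.coe_range, Set.mem_Iio] at ha hb
  have := congrArg ZMod.val (add_left_cancel hab)
  rwa [ZMod.val_natCast_of_lt (by omega), ZMod.val_natCast_of_lt (by omega)] at this

/-- The hyperedge consisting of the arcs of lengths `3` and `2` starting at `s` and `t`. -/
def arcPair (n s t : ℕ) : Set (ZMod n) := arc (s : ZMod n) 3 ∪ arc (t : ZMod n) 2

section

variable {n s t : ℕ} [NeZero n]

theorem mem_arcPair_iff (hn : 3 ≤ n) (hs : s < n) (ht : t < n) (v : ZMod n) :
    v ∈ arcPair n s t ↔ MemArcs n s t v.val := by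
  rw [arcPair, Set.mem_union, mem_arc_natCast_iff hs hn, mem_arc_natCast_iff ht (by omega)]

theorem encard_arcPair (hn : 3 ≤ n) (h : Separated n s t) : (arcPair n s t).encard = 5 := by
  obtain ⟨hs, ht, h⟩ := h
  rw [arcPair, Set.encard_union_eq, encard_arc hn, encard_arc (by omega)]
  · norm_num
  · rw [Set.disjoint_left]
    intro v hv hv'
    rw [mem_arc_natCast_iff hs hn] at hv
    rw [mem_arc_natCast_iff ht (by omega)] at hv'
    have := ZMod.val_lt v
    omega

theorem val_add_one_cases (hn : 1 < n) (v : ZMod n) :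
    v.val + 1 < n ∧ (v + 1).val = v.val + 1 ∨ v.val + 1 = n ∧ (v + 1).val = 0 := by
  have hv := ZMod.val_lt v
  have h1 : (1 : ZMod n).val = 1 := by
    have : Fact (1 < n) := ⟨hn⟩
    exact ZMod.val_one n
  rcases lt_or_eq_of_le (Nat.succ_le_of_lt hv) with h | h
  · left
    refine ⟨h, ?_⟩
    rw [ZMod.val_add, h1, Nat.mod_eq_of_lt h]
  · right
    refine ⟨h, ?_⟩
    rw [ZMod.val_add, h1]
    change (v.val.succ) % n = 0
    rw [h, Nat.mod_self]

theorem isSectionHyperedge_arcPair (hn : 3 ≤ n) (h : Separated n s t) :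
    IsSectionHyperedge (arcPair n s t) [3, 2] := by
  obtain ⟨hs, ht, h⟩ := h
  have pred {a : ℕ} (ha : a < n) : ((a : ZMod n) - 1).val + 1 = a ∨
      ((a : ZMod n) - 1).val + 1 = a + n := by
    have := val_add_one_cases (by omega) ((a : ZMod n) - 1)
    rw [sub_add_cancel, ZMod.val_natCast_of_lt ha] at this
    omega
  have shift {a : ℕ} (ha : a < n) {k : ℕ} (hk : k ≤ n) :
      ((a : ZMod n) + (k : ZMod n)).val = a + k ∨
      ((a : ZMod n) + (k : ZMod n)).val + n = a + k := by
    rw [← Nat.cast_add, ZMod.val_natCast]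
    rcases lt_or_ge (a + k) n with h | h
    · rw [Nat.mod_eq_of_lt h]; omega
    · rw [Nat.mod_eq_sub_mod h, Nat.mod_eq_of_lt (by omega)]; omega
  refine ⟨by simp, by simp, ![(s : ZMod n), (t : ZMod n)], ?_, ?_, ?_⟩
  · have hne : (s : ZMod n) ≠ t := by
      intro e
      have := congrArg ZMod.val e
      rw [ZMod.val_natCast_of_lt hs, ZMod.val_natCast_of_lt ht] at this
      omega
    intro a b hab
    fin_cases a <;> fin_cases b <;> simp_all
  · intro j
    fin_cases j
    · refine ⟨by simp, Set.subset_union_left, ?_, ?_⟩ <;> rw [mem_arcPair_iff hn hs ht]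
      · have := pred hs
        have := ZMod.val_lt ((s : ZMod n) - 1)
        change ¬ MemArcs n s t ((s : ZMod n) - 1).val
        omega
      · have := shift hs (k := 3) hn
        have := ZMod.val_lt ((s : ZMod n) + ((3 : ℕ) : ZMod n))
        change ¬ MemArcs n s t ((s : ZMod n) + ((3 : ℕ) : ZMod n)).val
        omega
    · refine ⟨by simp, Set.subset_union_right, ?_, ?_⟩ <;> rw [mem_arcPair_iff hn hs ht]
      · have := pred ht
        have := ZMod.val_lt ((t : ZMod n) - 1)
        change ¬ MemArcs n s t ((t : ZMod n) - 1).val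
        omega
      · have := shift ht (k := 2) (by omega)
        have := ZMod.val_lt ((t : ZMod n) + ((2 : ℕ) : ZMod n))
        change ¬ MemArcs n s t ((t : ZMod n) + ((2 : ℕ) : ZMod n)).val
        omega
  · ext v
    simp only [Set.mem_iUnion]
    constructor
    · rintro (h | h)
      · exact ⟨0, h⟩
      · exact ⟨1, h⟩
    · rintro ⟨j, h⟩
      fin_cases j
      · exact Or.inl h
      · exact Or.inr h

end

/-! ### From arc systems to hypergraphs -/

/-- A set of pairwise cyclically adjacent vertices lies on an edge of the cycle. -/
theorem exists_subset_pair {n : ℕ} [NeZero n] (hn : 4 ≤ n) (A : Set (ZMod n))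
    (h : ∀ v ∈ A, ∀ w ∈ A, w.val < v.val → v.val = w.val + 1 ∨ v.val + 1 = w.val + n) :
    ∃ k : ZMod n, A ⊆ {k, k + 1} := by
  have succ_eq {v w : ZMod n} (h : v.val = w.val + 1 ∨ v.val + n = w.val + 1) : v = w + 1 := by
    apply ZMod.val_injective n
    have := val_add_one_cases (by omega) w
    have := ZMod.val_lt v
    omega
  have key (v w : ZMod n) (hv : v ∈ A) (hw : w ∈ A) : v = w ∨ v = w + 1 ∨ w = v + 1 := by
    rcases lt_trichotomy w.val v.val with hlt | heq | hlt
    · rcases h v hv w hw hlt with h | h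
      · exact Or.inr (Or.inl (succ_eq (Or.inl h)))
      · exact Or.inr (Or.inr (succ_eq (Or.inr (by omega))))
    · exact Or.inl (ZMod.val_injective n heq.symm)
    · rcases h w hw v hv hlt with h | h
      · exact Or.inr (Or.inr (succ_eq (Or.inl h)))
      · exact Or.inr (Or.inl (succ_eq (Or.inr (by omega))))
  rcases A.eq_empty_or_nonempty with rfl | ⟨a, ha⟩
  · exact ⟨0, Set.empty_subset _⟩
  by_cases hb : ∃ b ∈ A, a = b + 1
  · obtain ⟨b, hbA, rfl⟩ := hb
    refine ⟨b, fun c hc => ?_⟩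
    have h₁ := key c b hc hbA
    have h₂ := key c (b + 1) hc ha
    have e₁ := val_add_one_cases (n := n) (by omega) b
    have e₂ := val_add_one_cases (n := n) (by omega) (b + 1)
    have e₃ := val_add_one_cases (n := n) (by omega) c
    rcases h₁ with h₁ | h₁ | h₁
    · exact Or.inl h₁
    · exact Or.inr h₁
    · rcases h₂ with h₂ | h₂ | h₂
      · exact Or.inr h₂
      -- Here `b = c + 1` and `c = b + 2`, so 3 would vanish modulo `n`; this is where `4 ≤ n` rules
      -- out the triangle.
      · have := congrArg ZMod.val h₁
        have := congrArg ZMod.val h₂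
        omega
      · exact Or.inl (add_right_cancel h₂).symm
  · push Not at hb
    refine ⟨a, fun c hc => ?_⟩
    rcases key c a hc ha with h | h | h
    · exact Or.inl h
    · exact Or.inr h
    · exact absurd h (hb c hc)

/-- Arithmetic criterion for a family of pairs of arcs to be a hypergraph as desired. -/
theorem exists_hypergraph_of_arcs {n : ℕ} (hn : 4 ≤ n) {ι : Type} [Fintype ι] (s t : ι → ℕ)
    (h : IsArcSystem n s t)
    (hcard : 2 * n ≤ 3 * Fintype.card ι ∧ 3 * Fintype.card ι < 2 * n + 3) :
    ∃ H : Hypergraph (ZMod n),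
      IsUniform H 5 ∧
      EI H = cycle n ∧
      H.edgeSet.encard = (⌈(2 * n : ℚ) / 3⌉₊ : ℕ) ∧
      {e ∈ H.edgeSet | ¬ IsSectionHyperedge e [3, 2]}.encard ≤ 2 := by
  have : NeZero n := ⟨by omega⟩
  have hn3 : 3 ≤ n := by omega
  obtain ⟨hsep, hmeet, hcover⟩ := h
  have hmem (i : ι) (v : ZMod n) : v ∈ arcPair n (s i) (t i) ↔ MemArcs n (s i) (t i) v.val :=
    mem_arcPair_iff hn3 (hsep i).1 (hsep i).2.1 v
  have hpair (k : ZMod n) : ({k, k + 1} : Set (ZMod n)).encard = 2 := by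
    apply Set.encard_pair
    intro h
    have := val_add_one_cases (n := n) (by omega) k
    rw [← h] at this
    omega
  have hinter (i j : ι) (hij : i ≠ j) :
      ∃ k : ZMod n, arcPair n (s i) (t i) ∩ arcPair n (s j) (t j) ⊆ {k, k + 1} := by
    apply exists_subset_pair hn
    rintro v ⟨hv, hv'⟩ w ⟨hw, hw'⟩ hlt
    rw [hmem] at hv hv' hw hw'
    exact hmeet i j hij v.val (ZMod.val_lt v) ⟨hv, hv'⟩ w.val hlt ⟨hw, hw'⟩
  have hinj : Function.Injective fun i => arcPair n (s i) (t i) := by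
    intro i j hij
    by_contra hne
    obtain ⟨k, hk⟩ := hinter i j hne
    have hij : arcPair n (s i) (t i) = arcPair n (s j) (t j) := hij
    rw [← hij, Set.inter_self] at hk
    have := Set.encard_le_encard hk
    rw [hpair, encard_arcPair hn3 (hsep i)] at this
    norm_num at this
  refine ⟨⟨Set.univ, Set.range fun i => arcPair n (s i) (t i), fun _ _ => Set.subset_univ _⟩,
    ?_, ?_, ?_, ?_⟩
  · rintro _ ⟨i, rfl⟩
    exact encard_arcPair hn3 (hsep i)
  · refine Hypergraph.ext rfl ?_
    ext A
    constructor
    · rintro ⟨_, ⟨i, rfl⟩, _, ⟨j, rfl⟩, hne, h2, rfl⟩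
      obtain ⟨k, hk⟩ := hinter i j fun h => hne (by rw [h])
      refine ⟨k, (Set.Finite.eq_of_subset_of_encard_le (Set.toFinite _) hk ?_).symm⟩
      rw [hpair]
      exact h2
    · rintro ⟨k, rfl⟩
      obtain ⟨i, j, hij, ⟨h₁, h₃⟩, h₂, h₄⟩ := hcover k.val (ZMod.val_lt k)
      have hsucc : (k + 1).val = if k.val + 1 = n then 0 else k.val + 1 := by
        have := val_add_one_cases (n := n) (by omega) k
        split_ifs <;> omega
      rw [← hsucc, ← hmem] at h₃ h₄
      rw [← hmem] at h₁ h₂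
      -- The intersection contains `{k, k + 1}` and lies in some `{l, l + 1}`, so cardinality forces
      -- equality.
      obtain ⟨l, hl⟩ := hinter i j hij
      have hsub : ({k, k + 1} : Set (ZMod n)) ⊆
          arcPair n (s i) (t i) ∩ arcPair n (s j) (t j) := by
        rintro v (rfl | rfl)
        exacts [⟨h₁, h₂⟩, ⟨h₃, h₄⟩]
      refine ⟨_, ⟨i, rfl⟩, _, ⟨j, rfl⟩, fun h => hij (hinj h), ?_, ?_⟩
      · rw [← hpair k]
        exact Set.encard_le_encard hsub
      · refine Set.Finite.eq_of_subset_of_encard_le (Set.toFinite _) hsub ?_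
        rw [hpair k, ← hpair l]
        exact Set.encard_le_encard hl
  · change (Set.range fun i => arcPair n (s i) (t i)).encard = _
    rw [← Set.image_univ, hinj.encard_image, Set.encard_univ, ENat.card_eq_coe_fintype_card]
    congr 1
    symm
    rw [Nat.ceil_eq_iff (by omega)]
    have h₁ : (2 * n : ℚ) ≤ 3 * Fintype.card ι := by exact_mod_cast hcard.1
    have h₂ : (3 * Fintype.card ι : ℚ) < 2 * n + 3 := by exact_mod_cast hcard.2
    rw [Nat.cast_sub (by omega)]
    constructor
    · push_cast
      linarith
    · linarith
  · have h : {e ∈ Set.range fun i => arcPair n (s i) (t i) |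
        ¬ IsSectionHyperedge e [3, 2]} = ∅ := by
      rw [Set.eq_empty_iff_forall_notMem]
      rintro _ ⟨⟨i, rfl⟩, hi⟩
      exact hi (isSectionHyperedge_arcPair hn3 (hsep i))
    change Set.encard {e ∈ Set.range fun i => arcPair n (s i) (t i) |
        ¬ IsSectionHyperedge e [3, 2]} ≤ 2
    rw [h, Set.encard_empty]
    exact zero_le


/-! ### The sporadic cases 18, 19, 20 -/

set_option synthInstance.maxSize 1000 in
set_option synthInstance.maxHeartbeats 200000 in
instance {n s t s' t' : ℕ} : Decidable (MeetAdjacent n s t s' t') :=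
  inferInstanceAs (Decidable (∀ y < n, MemArcs n s t y ∧ MemArcs n s' t' y →
    ∀ x < y, MemArcs n s t x ∧ MemArcs n s' t' x → y = x + 1 ∨ y + 1 = x + n))

-- For `m = 6` the general family fails: left edges `i` and `i + 3` would share four vertices.
-- Explicit systems replace it, verified by finite computation.
set_option synthInstance.maxSize 1000 in
set_option synthInstance.maxHeartbeats 200000 in
theorem isArcSystem_eighteen : IsArcSystem 18
    ![14, 6, 17, 5, 3, 9, 2, 0, 8, 15, 12, 11] ![10, 2, 5, 11, 13, 17, 16, 14, 4, 7, 8, 1] :=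
  ⟨by decide +kernel, by decide +kernel, by decide +kernel⟩

set_option synthInstance.maxSize 1000 in
set_option synthInstance.maxHeartbeats 200000 in
theorem isArcSystem_nineteen : IsArcSystem 19
    ![15, 5, 6, 11, 12, 0, 2, 14, 17, 8, 3, 9, 18] ![1, 11, 13, 16, 2, 7, 10, 4, 5, 17, 8, 14, 3] :=
  ⟨by decide +kernel, by decide +kernel, by decide +kernel⟩

set_option synthInstance.maxSize 1000 in
set_option synthInstance.maxHeartbeats 200000 in
theorem isArcSystem_twenty : IsArcSystem 20
    ![5, 6, 3, 14, 17, 9, 2, 15, 12, 0, 11, 8, 18, 19]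
    ![1, 16, 10, 2, 13, 17, 8, 4, 5, 11, 7, 14, 3, 8] :=
  ⟨by decide +kernel, by decide +kernel, by decide +kernel⟩

/-! ### The general family -/

/-- Initial vertices of the `3`-sections for `3 * m + r` vertices. -/
def tripleStart (m r : ℕ) : (Fin m ⊕ Fin m) ⊕ Fin r → ℕ
  | .inl (.inl i) => 3 * i
  | .inl (.inr i) => 3 * i + 2
  | .inr q => 3 * m + q

/-- Initial vertices of the `2`-sections for `3 * m + r` vertices. -/
def doubleStart (m r : ℕ) : (Fin m ⊕ Fin m) ⊕ Fin r → ℕ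
  | .inl (.inl i) => 3 * ((i + 3) % m) + 1
  | .inl (.inr i) => 3 * ((i + 2) % m) + 2
  | .inr q => 3 + 4 * q

theorem add_mod_cases {m i c : ℕ} (hi : i < m) (hc : c ≤ m) :
    (i + c) % m < m ∧ ((i + c) % m = i + c ∨ (i + c) % m + m = i + c) := by
  refine ⟨Nat.mod_lt _ (by omega), ?_⟩
  rcases lt_or_ge (i + c) m with h | h
  · rw [Nat.mod_eq_of_lt h]; omega
  · rw [Nat.mod_eq_sub_mod h, Nat.mod_eq_of_lt (by omega)]; omega

section

variable {m r i j i' j' : ℕ}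

/-- A common vertex forces `j - i ≡ 3` or `j - i ≡ -3` modulo `m`, and both cannot hold since `m`
does not divide 6. -/
theorem meetAdjacent_left_left (hm : 7 ≤ m) (hi : i < m) (hj : j < m) (hij : i ≠ j)
    (hi' : i' < m ∧ (i' = i + 3 ∨ i' + m = i + 3)) (hj' : j' < m ∧ (j' = j + 3 ∨ j' + m = j + 3)) :
    MeetAdjacent (3 * m + r) (3 * i) (3 * i' + 1) (3 * j) (3 * j' + 1) := by
  have common {x : ℕ} (h₁ : MemArcs (3 * m + r) (3 * i) (3 * i' + 1) x)
      (h₂ : MemArcs (3 * m + r) (3 * j) (3 * j' + 1) x) :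
      i' = j ∧ (x = 3 * j + 1 ∨ x = 3 * j + 2) ∨ j' = i ∧ (x = 3 * i + 1 ∨ x = 3 * i + 2) := by
    rcases h₁ with (h₁ | h₁) | (h₁ | h₁) <;> rcases h₂ with (h₂ | h₂) | (h₂ | h₂) <;> omega
  intro y _ hy x _ hx
  rcases common hy.1 hy.2 with hy | hy <;> rcases common hx.1 hx.2 with hx | hx <;> omega

theorem meetAdjacent_right_right (hm : 7 ≤ m) (hi : i < m) (hj : j < m) (hij : i ≠ j)
    (hi' : i' < m ∧ (i' = i + 2 ∨ i' + m = i + 2)) (hj' : j' < m ∧ (j' = j + 2 ∨ j' + m = j + 2)) :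
    MeetAdjacent (3 * m + r) (3 * i + 2) (3 * i' + 2) (3 * j + 2) (3 * j' + 2) := by
  have common {x : ℕ} (hx : x < 3 * m + r)
      (h₁ : MemArcs (3 * m + r) (3 * i + 2) (3 * i' + 2) x)
      (h₂ : MemArcs (3 * m + r) (3 * j + 2) (3 * j' + 2) x) :
      i' = j ∧ (x = 3 * j + 2 ∨ x = 3 * j + 3 ∨ x + (3 * m + r) = 3 * j + 3) ∨
      j' = i ∧ (x = 3 * i + 2 ∨ x = 3 * i + 3 ∨ x + (3 * m + r) = 3 * i + 3) := by
    rcases h₁ with (h₁ | h₁) | (h₁ | h₁) <;> rcases h₂ with (h₂ | h₂) | (h₂ | h₂) <;> omega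
  intro y hyn hy x hxy hx
  rcases common hyn hy.1 hy.2 with hy | hy <;>
    rcases common (by omega) hx.1 hx.2 with hx | hx <;> omega

theorem meetAdjacent_left_right (hm : 7 ≤ m) (hi : i < m) (hj : j < m)
    (hi' : i' < m ∧ (i' = i + 3 ∨ i' + m = i + 3)) (hj' : j' < m ∧ (j' = j + 2 ∨ j' + m = j + 2)) :
    MeetAdjacent (3 * m + r) (3 * i) (3 * i' + 1) (3 * j + 2) (3 * j' + 2) := by
  have common {x : ℕ} (hx : x < 3 * m + r)
      (h₁ : MemArcs (3 * m + r) (3 * i) (3 * i' + 1) x)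
      (h₂ : MemArcs (3 * m + r) (3 * j + 2) (3 * j' + 2) x) :
      -- The seven cases are `i - j ≡ 0, 1, 2, 3, -3, -2, -1` modulo `m`, pairwise exclusive exactly
      -- because `m ≥ 7`; only the second allows two vertices, and these are adjacent.
      i = j ∧ x = 3 * i + 2 ∨
      (i = j + 1 ∨ i + m = j + 1) ∧ (x = 3 * i ∨ x = 3 * i + 1) ∨
      j' = i ∧ x = 3 * i + 2 ∨
      (i = j' + 1 ∨ i + m = j' + 1) ∧ x = 3 * i ∨
      i' = j ∧ x = 3 * j + 2 ∨
      (i' = j + 1 ∨ i' + m = j + 1) ∧ x = 3 * i' + 1 ∨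
      i' = j' ∧ x = 3 * i' + 2 := by
    rcases h₁ with (h₁ | h₁) | (h₁ | h₁) <;> rcases h₂ with (h₂ | h₂) | (h₂ | h₂) <;> omega
  intro y hyn hy x hxy hx
  rcases common hyn hy.1 hy.2 with hy | hy | hy | hy | hy | hy | hy <;>
    rcases common (by omega) hx.1 hx.2 with hx | hx | hx | hx | hx | hx | hx <;> omega

/-- The pairs `{3, 4}` and `{7, 8}` of the extra hyperedges merely bring their size to five: each is
already an edge of the cycle, and the cover never relies on them. -/
theorem meetAdjacent_left_extra {q : ℕ} (hm : 7 ≤ m) (hr : r ≤ 2) (hi : i < m) (hq : q < r)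
    (hi' : i' < m ∧ (i' = i + 3 ∨ i' + m = i + 3)) :
    MeetAdjacent (3 * m + r) (3 * i) (3 * i' + 1) (3 * m + q) (3 + 4 * q) := by
  intro y hyn ⟨hy, hy'⟩ x hxy ⟨hx, hx'⟩
  rcases hy' with (hy' | hy') | (hy' | hy') <;> rcases hx' with (hx' | hx') | (hx' | hx') <;> omega

theorem meetAdjacent_right_extra {q : ℕ} (hm : 7 ≤ m) (hr : r ≤ 2) (hj : j < m) (hq : q < r)
    (hj' : j' < m ∧ (j' = j + 2 ∨ j' + m = j + 2)) :
    MeetAdjacent (3 * m + r) (3 * j + 2) (3 * j' + 2) (3 * m + q) (3 + 4 * q) := by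
  obtain rfl | rfl : q = 0 ∨ q = 1 := by omega
  all_goals
    intro y hyn ⟨hy, hy'⟩ x hxy ⟨hx, hx'⟩
    rcases hy' with (hy' | hy') | (hy' | hy') <;>
      rcases hx' with (hx' | hx') | (hx' | hx') <;> omega

theorem meetAdjacent_extra_extra {p q : ℕ} (hm : 7 ≤ m) (hr : r ≤ 2) (hp : p < r) (hq : q < r)
    (hpq : p ≠ q) :
    MeetAdjacent (3 * m + r) (3 * m + p) (3 + 4 * p) (3 * m + q) (3 + 4 * q) := by
  intro y hyn ⟨hy, hy'⟩ x hxy ⟨hx, hx'⟩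
  rcases hy' with (hy' | hy') | (hy' | hy') <;> rcases hx' with (hx' | hx') | (hx' | hx') <;> omega

end

theorem isArcSystem_three_mul_add {m r : ℕ} (hm : 7 ≤ m) (hr : r ≤ 2) :
    IsArcSystem (3 * m + r) (tripleStart m r) (doubleStart m r) where
  separated := by
    rintro ((i | i) | q)
    · have := add_mod_cases (c := 3) i.isLt (by omega)
      have := i.isLt
      simp only [tripleStart, doubleStart]
      omega
    · have := add_mod_cases (c := 2) i.isLt (by omega)
      have := i.isLt
      simp only [tripleStart, doubleStart]
      omega
    · have := q.isLt
      simp only [tripleStart, doubleStart]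
      omega
  meet := by
    have left (i : Fin m) := add_mod_cases (c := 3) i.isLt (by omega)
    have right (i : Fin m) := add_mod_cases (c := 2) i.isLt (by omega)
    rintro ((i | i) | p) ((j | j) | q) hij
    · exact meetAdjacent_left_left hm i.isLt j.isLt (fun h => hij (by rw [Fin.ext h]))
        (left i) (left j)
    · exact meetAdjacent_left_right hm i.isLt j.isLt (left i) (right j)
    · exact meetAdjacent_left_extra hm hr i.isLt q.isLt (left i)
    · exact (meetAdjacent_left_right hm j.isLt i.isLt (left j) (right i)).symm
    · exact meetAdjacent_right_right hm i.isLt j.isLt (fun h => hij (by rw [Fin.ext h]))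
        (right i) (right j)
    · exact meetAdjacent_right_extra hm hr i.isLt q.isLt (right i)
    · exact (meetAdjacent_left_extra hm hr j.isLt p.isLt (left j)).symm
    · exact (meetAdjacent_right_extra hm hr j.isLt p.isLt (right j)).symm
    · exact meetAdjacent_extra_extra hm hr p.isLt q.isLt (fun h => hij (by rw [Fin.ext h]))
  cover := by
    intro k hk
    -- The left edge whose pair lies in block `j`; it differs from left edge `j` because 3 is
    -- nonzero modulo `m`.
    have left_inv (j : ℕ) (hj : j < m) : ∃ i : Fin m, (i + 3) % m = j ∧ (i : ℕ) ≠ j := by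
      refine ⟨⟨if 3 ≤ j then j - 3 else j + m - 3, by split_ifs <;> omega⟩, ?_⟩
      dsimp only
      split_ifs with h
      · exact ⟨by rw [Nat.sub_add_cancel h, Nat.mod_eq_of_lt hj], by omega⟩
      · refine ⟨?_, by omega⟩
        rw [Nat.sub_add_cancel (by omega), Nat.add_mod_right, Nat.mod_eq_of_lt hj]
    have right_inv (j : ℕ) (hj : j < m) : ∃ i : Fin m, (i + 2) % m = j ∧ (i : ℕ) ≠ j := by
      refine ⟨⟨if 2 ≤ j then j - 2 else j + m - 2, by split_ifs <;> omega⟩, ?_⟩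
      dsimp only
      split_ifs with h
      · exact ⟨by rw [Nat.sub_add_cancel h, Nat.mod_eq_of_lt hj], by omega⟩
      · refine ⟨?_, by omega⟩
        rw [Nat.sub_add_cancel (by omega), Nat.add_mod_right, Nat.mod_eq_of_lt hj]
    rcases lt_or_ge k (3 * m) with hkm | hkm
    · obtain ⟨a, c, hc, rfl⟩ : ∃ a c, c < 3 ∧ k = 3 * a + c :=
        ⟨k / 3, k % 3, Nat.mod_lt _ (by norm_num), (Nat.div_add_mod k 3).symm⟩
      have ha : a < m := by omega
      interval_cases c
      · rcases Nat.eq_zero_or_pos a with rfl | hpos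
        -- The triple ending at vertex 1 belongs to the last right edge if `r = 0`, and to the last
        -- extra hyperedge otherwise.
        · rcases Nat.eq_zero_or_pos r with rfl | hr0
          · refine ⟨.inl (.inl ⟨0, ha⟩), .inl (.inr ⟨m - 1, by omega⟩), by simp, ?_, ?_⟩ <;>
              simp only [tripleStart, doubleStart, MemArcsSucc] <;> split_ifs <;> omega
          · refine ⟨.inl (.inl ⟨0, ha⟩), .inr ⟨r - 1, by omega⟩, by simp, ?_, ?_⟩ <;>
              simp only [tripleStart, doubleStart, MemArcsSucc] <;> split_ifs <;> omega
        · refine ⟨.inl (.inl ⟨a, ha⟩), .inl (.inr ⟨a - 1, by omega⟩), by simp, ?_, ?_⟩ <;>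
            simp only [tripleStart, doubleStart, MemArcsSucc] <;> split_ifs <;> omega
      · obtain ⟨i, hi, hne⟩ := left_inv a ha
        refine ⟨.inl (.inl ⟨a, ha⟩), .inl (.inl i), ?_, ?_, ?_⟩
        · simpa [Fin.ext_iff] using hne.symm
        all_goals
          simp only [tripleStart, doubleStart, MemArcsSucc, hi]; split_ifs <;> omega
      · obtain ⟨i, hi, hne⟩ := right_inv a ha
        refine ⟨.inl (.inr ⟨a, ha⟩), .inl (.inr i), ?_, ?_, ?_⟩
        · simpa [Fin.ext_iff] using hne.symm
        all_goals
          simp only [tripleStart, doubleStart, MemArcsSucc, hi]; split_ifs <;> omega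
    · rcases Nat.eq_or_lt_of_le hkm with rfl | hlt
      · refine ⟨.inl (.inr ⟨m - 1, by omega⟩), .inr ⟨0, by omega⟩, by simp, ?_, ?_⟩ <;>
          simp only [tripleStart, doubleStart, MemArcsSucc] <;> split_ifs <;> omega
      · refine ⟨.inr ⟨0, by omega⟩, .inr ⟨1, by omega⟩, by simp, ?_, ?_⟩ <;>
          simp only [tripleStart, doubleStart, MemArcsSucc] <;> split_ifs <;> omega

end EdgeIntersection

theorem theorem4p5 (n : ℕ) (hn : 18 ≤ n) :
    ∃ H : Hypergraph (ZMod n),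
      EdgeIntersection.IsUniform H 5 ∧
      EdgeIntersection.EI H = EdgeIntersection.cycle n ∧
      H.edgeSet.encard = (⌈(2 * n : ℚ) / 3⌉₊ : ℕ) ∧
      {e ∈ H.edgeSet | ¬ EdgeIntersection.IsSectionHyperedge e [3, 2]}.encard ≤ 2 := by
  obtain h | h | h | h : n = 18 ∨ n = 19 ∨ n = 20 ∨ 21 ≤ n := by omega
  · subst h
    exact EdgeIntersection.exists_hypergraph_of_arcs (by omega) _ _
      EdgeIntersection.isArcSystem_eighteen (by simp)
  · subst h
    exact EdgeIntersection.exists_hypergraph_of_arcs (by omega) _ _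
      EdgeIntersection.isArcSystem_nineteen (by simp)
  · subst h
    exact EdgeIntersection.exists_hypergraph_of_arcs (by omega) _ _
      EdgeIntersection.isArcSystem_twenty (by simp)
  · obtain ⟨m, r, hm, hr, rfl⟩ : ∃ m r, 7 ≤ m ∧ r ≤ 2 ∧ n = 3 * m + r :=
      ⟨n / 3, n % 3, by omega, by omega, by omega⟩
    refine EdgeIntersection.exists_hypergraph_of_arcs (by omega) _ _
      (EdgeIntersection.isArcSystem_three_mul_add hm hr) ?_
    simp only [Fintype.card_sum, Fintype.card_fin]
    omega
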